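/- **Setting.** Momentum space is $\mathbb R\times\mathbb R^d$, $p=(\omega,\mathbf p)$. Consider Feynman rules for a real field with one type of particle, with measurable dispersion law $\omega(\mathbf p)$. A momentum is on shell if $\omega=\omega(\mathbf p)$ or $\omega=-\omega(-\mathbf p)$. Vertices are of two types, $+$ and $-$; a vertex of type $\pm$ with incoming momenta $k_1,\dots,k_r$ carries a factor $V^{\pm}(k_1,\dots,k_r)\,\delta(k_1+\dots+k_r)$ with $V^\pm$ symmetric (any valence, locality not required). An internal edge between two $+$ (two $-$) vertices carries an even propagator $G_{++}$ ($G_{--}$). An edge between a $+$ and a $-$ vertex (a $+-$ edge) carries the on-shell propagator $G_{+-}(q)=M(\mathbf q)\,\delta(\omega+\omega(-\mathbf q))$, where $q$ enters the $+$ end and $-q$ the $-$ end (for even $\omega(\cdot)$ this is $M(\mathbf q)\delta(\omega+\omega(\mathbf q))$). The singularities of $G_{++}$, $G_{--}$ (the $i0$) and the conservation delta functions are understood as limits $\eta\to0+$ of functions $G^\eta_{++},G^\eta_{--},\delta^\eta$, with $\delta^\eta\to\delta$ (also $V^\pm$ may depend on $\eta$); $G_{+-}$ is not regularized. A diagram with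 external legs $(p_1,\epsilon_1),\dots,(p_n,\epsilon_n)$, $\epsilon_i=\pm1$, $p_i$ on shell, is a finite graph with vertices of types $\pm$ and $n$ labelled amputated legs, the $i$-th attached to a vertex of type $\epsilon_i$ and bringing in momentum $p_i$. Its contribution is the integral over the momenta of all internal edges of the product of propagators and vertex factors, divided by the order of its automorphism group. In a fixed order (number $N$ of vertices, number $H$ of half-edges, legs included), $\hat G_n(p_1,\epsilon_1,\dots,p_n,\epsilon_n)$ is the sum of the contributions of all connected diagrams up to isomorphism. A $+-$ edge of a connected diagram is non-separating if the diagram stays connected when it is removed. **Statement.** Let $\Sigma_n(p_1,\epsilon_1,\dots,p_n,\epsilon_n)$ be the sum of all diagrams for $\hat G_n(p_1,\epsilon_1,\dots,p_n,\epsilon_n)$ with a chosen non-separating $+-$ edge (so the contribution of a diagram is counted once for each such edge that it contains). (i) Let $\eta>0$ and let $p_1,\dots,p_n$ be on shell. If the integrals of the connected diagrams with a non-separating $+-$ edge converge absolutely, then the following integral converges absolutely and, in every order $(N,H)$, $$\Sigma_n(p_1,\epsilon_1,\dots,p_n,\epsilon_n)=\int dq\,G_{+-}(q)\,\hat G_{n+2}(p_1,\epsilon_1,\dots,p_n,\epsilon_n,q,+1,-q,-1),$$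 where $\hat G_{n+2}$ is taken in the same order $(N,H)$ (thus with one internal edge less). (ii) Fix the energy signs of the $p_i$ and suppose that the convergence in (i) holds for every $\eta>0$ and almost all $\mathbf p_1,\dots,\mathbf p_n$. Then one side has a limit for $\eta\to0+$, in the sense of distributions in $(\mathbf p_1,\dots,\mathbf p_n)$, if and only if the other has, and the limits are equal. -/

import Mathlib

open MeasureTheory Filter Topology
open scoped ContDiff

noncomputable section

namespace Keldysh

/-- Spatial momenta. -/
abbrev SMom (d : ℕ) := EuclideanSpace ℝ (Fin d)

/-- Energy-momentum vectors `p = (ω, 𝐩)`. -/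
abbrev Mom (d : ℕ) := ℝ × SMom d

/-- The Feynman rules for the generalized Green functions of a real field with one type of particle
in `d` space dimensions. The index `+1` / `-1` of a vertex is its `+` / `-` type.

The propagator `G_{+-}(q) = M(𝐪) δ(ω + ω(-𝐪))` (for an even dispersion law,
`M(𝐪) δ(ω + ω(𝐪))`) is kept exactly on shell, and `G_{-+}(q) = G_{+-}(-q)`. The two other
sources of singularities, the `i0` in `G_{++}`, `G_{--}` and the delta functions of momentum
conservation in the vertices, are boundary values for `η → 0+`: for instance
`G_{++} = i ħ / (p² - m² + i η)`, and `delta η` is a family of functions that tends to `δ`.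
Vertices may be non-local, of any valence, and may contain regulator-dependent counterterms; a
vertex is a function of the multiset of momenta that enter it (so it is symmetric). Constant
factors (`2π`, `ħ`, couplings) are part of `M`, `Gpp`, `Gmm`, `vertex`. -/
structure Theory (d : ℕ) where
  /-- dispersion law -/
  disp : SMom d → ℝ
  measurable_disp : Measurable disp
  /-- the coefficient of the on-shell delta function in `G_{+-}` -/
  M : SMom d → ℂ
  Gpp : ℝ → Mom d → ℂ
  Gmm : ℝ → Mom d → ℂ
  Gpp_neg : ∀ η q, Gpp η (-q) = Gpp η q
  Gmm_neg : ∀ η q, Gmm η (-q) = Gmm η q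
  vertex : ℝ → ℤˣ → Multiset (Mom d) → ℂ
  delta : ℝ → Mom d → ℂ
  continuous_delta : ∀ η, 0 < η → Continuous (delta η)
  tendsto_delta : ∀ f : Mom d → ℂ, Continuous f → HasCompactSupport f →
    Tendsto (fun η => ∫ k, delta η k * f k) (𝓝[>] 0) (𝓝 (f 0))

namespace Theory

variable {d : ℕ} (T : Theory d)

/-- On-shell momenta, of positive energy `ω = ω(𝐩)` or of negative energy `ω = -ω(-𝐩)`. -/
def Shell : Type :=
  {p : Mom d // p.1 = T.disp p.2 ∨ p.1 = -T.disp (-p.2)}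

/-- The on-shell momentum with spatial part `k` and energy sign `s`. -/
def onShell (s : ℤˣ) (k : SMom d) : T.Shell :=
  if s = 1 then ⟨(T.disp k, k), Or.inl rfl⟩ else ⟨(-T.disp (-k), k), Or.inr rfl⟩

instance : Neg T.Shell where
  neg p := ⟨-p.1, by
    rcases p.2 with h | h
    · right; simp [h]
    · left; simp [h]⟩

/-- The measure `δ(ω + ω(-𝐪)) dq` on momentum space. -/
def shellMeasure : Measure (Mom d) :=
  Measure.map (fun k : SMom d => (-T.disp (-k), k)) volume

end Theory

/-- Diagrams with `N` vertices, `H` half-edges and `n` amputated external legs of types `ε i`.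
Vertices and half-edges carry labels here; diagrams proper are isomorphism classes. Internal edges
are the two-element orbits of `pair`, legs are its fixed points. -/
@[ext]
structure Diagram (n N H : ℕ) (ε : Fin n → ℤˣ) where
  /-- type of a vertex -/
  sign : Fin N → ℤˣ
  /-- the vertex to which a half-edge is attached -/
  att : Fin H → Fin N
  pair : Fin H → Fin H
  leg : Fin n → Fin H
  pair_pair : ∀ h, pair (pair h) = h
  leg_injective : Function.Injective leg
  pair_eq_iff : ∀ h, pair h = h ↔ ∃ i, leg i = h
  sign_leg : ∀ i, sign (att (leg i)) = ε i

namespace Diagram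

variable {n N H : ℕ} {ε : Fin n → ℤˣ} (Γ : Diagram n N H ε)

instance : Finite (Diagram n N H ε) :=
  Finite.of_injective
    (fun Γ : Diagram n N H ε => (Γ.sign, Γ.att, Γ.pair, Γ.leg)) (by
      intro Γ Δ h
      simp only [Prod.mk.injEq] at h
      exact Diagram.ext h.1 h.2.1 h.2.2.1 h.2.2.2)

/-- The vertex graph (multiplicities and self-loops do not matter for connectedness). -/
def graph : SimpleGraph (Fin N) :=
  SimpleGraph.fromRel fun u v => ∃ h, Γ.att h = u ∧ Γ.att (Γ.pair h) = v

def Connected : Prop := Γ.graph.Connected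

/-- The vertex graph after removal of the edge `{e, pair e}`. -/
def graphWithout (e : Fin H) : SimpleGraph (Fin N) :=
  SimpleGraph.fromRel fun u v =>
    ∃ h, h ≠ e ∧ h ≠ Γ.pair e ∧ Γ.att h = u ∧ Γ.att (Γ.pair h) = v

/-- `h` is the `+` end of a `+-` edge. -/
def IsPlusMinus (h : Fin H) : Prop :=
  Γ.sign (Γ.att h) = 1 ∧ Γ.sign (Γ.att (Γ.pair h)) = -1

open Classical in
/-- The non-separating `+-` edges of a connected diagram, each represented by its `+` end. -/
def nonSepPM : Finset (Fin H) :=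
  Finset.univ.filter fun e => Γ.IsPlusMinus e ∧ (Γ.graphWithout e).Connected

/-- The end of an internal edge that represents the edge: the `+` end of a `+-` edge, an arbitrary
end of a `++` or `--` edge (whose propagator is even). -/
def IsHead (h : Fin H) : Prop :=
  Γ.IsPlusMinus h ∨ (Γ.sign (Γ.att h) = Γ.sign (Γ.att (Γ.pair h)) ∧ h < Γ.pair h)

/-- Internal edges. -/
def Edge : Type := {h : Fin H // Γ.IsHead h}

instance : Fintype Γ.Edge := by
  classical
  unfold Edge
  infer_instance

/-- Isomorphisms of diagrams: relabellings of vertices and half-edges; external legs are fixed. -/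
def IsIso (Γ Δ : Diagram n N H ε) (φ : Equiv.Perm (Fin N) × Equiv.Perm (Fin H)) : Prop :=
  (∀ v, Δ.sign (φ.1 v) = Γ.sign v) ∧
  (∀ h, Δ.att (φ.2 h) = φ.1 (Γ.att h)) ∧
  (∀ h, Δ.pair (φ.2 h) = φ.2 (Γ.pair h)) ∧
  (∀ i, Δ.leg i = φ.2 (Γ.leg i))

/-- The order of the automorphism group. -/
def symm : ℕ := Nat.card {φ // IsIso Γ Γ φ}

variable {d : ℕ}

open Classical in
/-- The momentum that a half-edge brings into its vertex, given the external momenta `p` and the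
momenta `q` of the internal edges. -/
def mom (p : Fin n → Mom d) (q : Γ.Edge → Mom d) (h : Fin H) : Mom d :=
  if hh : Γ.IsHead h then q ⟨h, hh⟩
  else if hh : Γ.IsHead (Γ.pair h) then -q ⟨Γ.pair h, hh⟩
  else Function.extend Γ.leg p 0 h

open Classical in
/-- The momenta that enter the vertex `v`. -/
def momAt (p : Fin n → Mom d) (q : Γ.Edge → Mom d) (v : Fin N) : Multiset (Mom d) :=
  (Finset.univ.filter fun h => Γ.att h = v).val.map (Γ.mom p q)

open Classical in
/-- Together with `edgeFactor`, the propagator of an edge: `G dq = edgeFactor · edgeMeasure`. -/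
def edgeMeasure (T : Theory d) (e : Γ.Edge) : Measure (Mom d) :=
  if Γ.IsPlusMinus e.1 then T.shellMeasure else volume

open Classical in
def edgeFactor (T : Theory d) (η : ℝ) (e : Γ.Edge) (q : Mom d) : ℂ :=
  if Γ.IsPlusMinus e.1 then T.M q.2
  else if Γ.sign (Γ.att e.1) = 1 then T.Gpp η q else T.Gmm η q

def integrand (T : Theory d) (η : ℝ) (p : Fin n → Mom d) (q : Γ.Edge → Mom d) : ℂ :=
  (∏ e, Γ.edgeFactor T η e (q e)) *
    ∏ v, T.vertex η (Γ.sign v) (Γ.momAt p q v) * T.delta η (Γ.momAt p q v).sum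

/-- The integral of the diagram over the momenta of its internal edges, at on-shell external
momenta. -/
def contribution (T : Theory d) (η : ℝ) (p : Fin n → T.Shell) : ℂ :=
  ∫ q, Γ.integrand T η (fun i => (p i).1) q ∂(Measure.pi (Γ.edgeMeasure T))

def Converges (T : Theory d) (η : ℝ) (p : Fin n → T.Shell) : Prop :=
  Integrable (Γ.integrand T η (fun i => (p i).1)) (Measure.pi (Γ.edgeMeasure T))

end Diagram

/-- Connected diagrams up to isomorphism. -/
def connSetoid (n N H : ℕ) (ε : Fin n → ℤˣ) : Setoid {Γ : Diagram n N H ε // Γ.Connected} where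
  r Γ Δ := ∃ φ, Diagram.IsIso Γ.1 Δ.1 φ
  iseqv :=
    { refl := fun _ => ⟨(1, 1), by simp [Diagram.IsIso]⟩
      symm := by
        rintro Γ Δ ⟨φ, h1, h2, h3, h4⟩
        refine ⟨φ⁻¹, fun v => ?_, fun h => ?_, fun h => ?_, fun i => ?_⟩
        · simpa using (h1 (φ.1⁻¹ v)).symm
        · have := h2 (φ.2⁻¹ h)
          have hh : φ.2 (φ.2⁻¹ h) = h := by simp
          rw [hh] at this
          simp [this]
        · have := h3 (φ.2⁻¹ h)
          have hh : φ.2 (φ.2⁻¹ h) = h := by simp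
          rw [hh] at this
          simp [this]
        · simp [h4 i]
      trans := by
        rintro Γ Δ Θ ⟨φ, h1, h2, h3, h4⟩ ⟨ψ, k1, k2, k3, k4⟩
        refine ⟨ψ * φ, fun v => ?_, fun h => ?_, fun h => ?_, fun i => ?_⟩
        · simp [k1, h1]
        · simp [k2, h2]
        · simp [k3, h3]
        · simp [k4, h4] }

def DiagramClass (n N H : ℕ) (ε : Fin n → ℤˣ) : Type := Quotient (connSetoid n N H ε)

instance (n N H : ℕ) (ε : Fin n → ℤˣ) : Finite (DiagramClass n N H ε) := by
  unfold DiagramClass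
  infer_instance

instance (n N H : ℕ) (ε : Fin n → ℤˣ) : Fintype (DiagramClass n N H ε) := Fintype.ofFinite _

/-- A diagram in the class (nothing below depends on the choice). -/
def DiagramClass.rep {n N H : ℕ} {ε : Fin n → ℤˣ} (c : DiagramClass n N H ε) : Diagram n N H ε :=
  (Quotient.out c).1

namespace Theory

variable {d : ℕ} (T : Theory d)

/-- The contribution of order (`N` vertices, `H` half-edges) to the connected amputated on-shell
function `Ĝ_n(p_1, ε_1, …, p_n, ε_n)`: the sum of all connected diagrams, each divided by the
order of its automorphism group. -/
def Ghat (N H : ℕ) (η : ℝ) {n : ℕ} (ε : Fin n → ℤˣ) (p : Fin n → T.Shell) : ℂ :=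
  ∑ c : DiagramClass n N H ε, c.rep.contribution T η p / c.rep.symm

/-- The part of `Ghat` that comes from diagrams containing a non-separating `+-` edge: the sum over
all diagrams with a chosen such edge, that is, a diagram is counted once for each of them. -/
def sumNonSep (N H : ℕ) (η : ℝ) {n : ℕ} (ε : Fin n → ℤˣ) (p : Fin n → T.Shell) : ℂ :=
  ∑ c : DiagramClass n N H ε, ∑ _e ∈ c.rep.nonSepPM, c.rep.contribution T η p / c.rep.symm

/-- `Ĝ_{n+2}(p_1, ε_1, …, p_n, ε_n, q, +1, -q, -1)`. -/
def GhatCut (N H : ℕ) (η : ℝ) {n : ℕ} (ε : Fin n → ℤˣ) (p : Fin n → T.Shell) (q : T.Shell) : ℂ :=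
  T.Ghat N H η (Fin.append ε ![1, -1]) (Fin.append p ![q, -q])

/-- `∫ dq G_{+-}(q) F(q)`, where `G_{+-}(q) = M(𝐪) δ(ω + ω(-𝐪))`. -/
def intGpm (F : T.Shell → ℂ) : ℂ := ∫ k : SMom d, T.M k * F (T.onShell (-1) k)

/-- Existence of that integral. -/
def IntegrableGpm (F : T.Shell → ℂ) : Prop :=
  Integrable (fun k : SMom d => T.M k * F (T.onShell (-1) k))

/-- `F η`, as a distribution in the spatial parts of the on-shell external momenta (with energy
signs `s i`), tends to `L` when the regulator is removed. -/
def IsLimit {n : ℕ} (s : Fin n → ℤˣ) (F : ℝ → (Fin n → T.Shell) → ℂ)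
    (L : ((Fin n → SMom d) → ℂ) → ℂ) : Prop :=
  ∀ f : (Fin n → SMom d) → ℂ, ContDiff ℝ ∞ f → HasCompactSupport f →
    (∀ᶠ η in 𝓝[>] (0 : ℝ), Integrable
      (fun k : Fin n → SMom d => f k * F η (fun i => T.onShell (s i) (k i)))) ∧
    Tendsto (fun η => ∫ k : Fin n → SMom d, f k * F η (fun i => T.onShell (s i) (k i)))
      (𝓝[>] 0) (𝓝 (L f))

end Theory

end Keldysh

end

/-! The identity is a bijection of labelled diagrams combined with Fubini's theorem.

Combinatorics. By the orbit-stabilizer theorem, a sum over isomorphism classes weighted by inverse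
symmetry factors is the sum over labelled diagrams divided by the order `N! H!` of the relabelling
group (`sum_class_div_symm`). Cutting an edge changes neither `N` nor `H`, so both sides of the
identity carry the same denominator. For labelled diagrams, cutting a `+-` edge and joining the last
two legs are inverse operations: the two ends of the edge are distinguished by their types, so no
factor 2 arises. The cut diagram is connected exactly when the edge is non-separating
(`graphWithout_glue`, `sum_nonSepPM`).

Analysis. The integrand of the joined diagram is `M` times that of the cut diagram with external
momenta `q`, `-q` on the new legs (`integrand_glue`). The measure of the new edge lives on the
shell, so these legs are on shell, and Fubini's theorem makes `q` the outer variable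
(`Converges.glue`).

The passage to labelled diagrams requires that isomorphic diagrams have equal integrals
(`IsIso.contribution_eq`). The limit statement follows because the two regularized functions agree
almost everywhere. -/

noncomputable section

namespace Keldysh

/-! ### Product measures: reindexing variables and splitting one off. -/

section PiMeasure

variable {α ι κ : Type*}

/-- Invariance of an integral over finitely many variables under a reindexing of the variables
combined with measure preserving transformations of each of them. -/
theorem integral_pi_reindex {E : Type*} [NormedAddCommGroup E] [NormedSpace ℝ E]
    [MeasurableSpace α] [Fintype ι] [Fintype κ] (σ : ι ≃ κ) (μ : ι → Measure α) (ν : κ → Measure α)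
    [∀ i, SigmaFinite (μ i)] [∀ k, SigmaFinite (ν k)] (g : ι → α ≃ᵐ α)
    (hg : ∀ i, MeasurePreserving (g i) (ν (σ i)) (μ i)) (F : (ι → α) → E) :
    ∫ q, F (fun i => g i (q (σ i))) ∂Measure.pi ν = ∫ q, F q ∂Measure.pi μ := by
  have h1 := (measurePreserving_piCongrLeft (α := fun _ : κ => α) ν σ).symm
  have h2 : MeasurePreserving (MeasurableEquiv.piCongrRight g)
      (Measure.pi fun i => ν (σ i)) (Measure.pi μ) := measurePreserving_pi _ _ hg
  have h3 := (h2.comp h1).integral_comp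
    ((MeasurableEquiv.piCongrRight g).measurableEmbedding.comp
      (MeasurableEquiv.piCongrLeft (fun _ : κ => α) σ).symm.measurableEmbedding) F
  exact h3

/-- The assignment of `x` to the distinguished index `σ none` and of `q i` to `σ (some i)`. -/
def insertVar (σ : Option ι ≃ κ) (z : (ι → α) × α) (k : κ) : α :=
  (σ.symm k).elim z.2 z.1

@[simp] theorem insertVar_none (σ : Option ι ≃ κ) (z : (ι → α) × α) :
    insertVar σ z (σ none) = z.2 := by simp [insertVar]

@[simp] theorem insertVar_some (σ : Option ι ≃ κ) (z : (ι → α) × α) (i : ι) :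
    insertVar σ z (σ (some i)) = z.1 i := by simp [insertVar]

theorem insertVar_eq [MeasurableSpace α] (σ : Option ι ≃ κ) :
    insertVar (α := α) σ = MeasurableEquiv.piCongrLeft (fun _ : κ => α) σ ∘
      (MeasurableEquiv.piOptionEquivProd (fun _ : Option ι => α)).symm := by
  funext z k
  obtain ⟨o, rfl⟩ := σ.surjective k
  rw [Function.comp_apply, MeasurableEquiv.piCongrLeft_apply_apply]
  cases o <;> simp <;> rfl

theorem measurableEmbedding_insertVar [MeasurableSpace α] (σ : Option ι ≃ κ) :
    MeasurableEmbedding (insertVar (α := α) σ) := by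
  rw [insertVar_eq]
  exact (MeasurableEquiv.measurableEmbedding _).comp (MeasurableEquiv.measurableEmbedding _)

theorem measurePreserving_insertVar [MeasurableSpace α] [Fintype ι] [Fintype κ]
    (σ : Option ι ≃ κ) (μ : κ → Measure α) [∀ k, SigmaFinite (μ k)] :
    MeasurePreserving (insertVar σ)
      ((Measure.pi fun i => μ (σ (some i))).prod (μ (σ none))) (Measure.pi μ) := by
  rw [insertVar_eq]
  refine (measurePreserving_piCongrLeft (α := fun _ : κ => α) μ σ).comp ⟨?_, ?_⟩
  · exact MeasurableEquiv.measurable _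
  · exact Measure.pi_map_piOptionEquivProd (β := fun _ : Option ι => α) fun o => μ (σ o)

end PiMeasure

/-! ### The on-shell measure. -/

namespace Theory

variable {d : ℕ} (T : Theory d)

/-- A measurable injection between standard Borel spaces is an embedding. This allows integrals over
the shell to be pulled back to spatial momenta although `M` and the vertex factors are not assumed
measurable. -/
theorem measurableEmbedding_shell :
    MeasurableEmbedding (fun k : SMom d => (-T.disp (-k), k)) := by
  refine Measurable.measurableEmbedding ?_ fun a b h => (Prod.ext_iff.1 h).2
  exact (T.measurable_disp.comp measurable_neg).neg.prodMk measurable_id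

theorem measurePreserving_shell :
    MeasurePreserving (fun k : SMom d => (-T.disp (-k), k)) volume T.shellMeasure :=
  ⟨T.measurableEmbedding_shell.measurable, rfl⟩

instance : SigmaFinite T.shellMeasure := T.measurableEmbedding_shell.sigmaFinite_map

end Theory

/-! ### Heads of edges and the momenta of half-edges. -/

namespace Diagram

variable {n N H : ℕ} {ε : Fin n → ℤˣ} (Γ : Diagram n N H ε) {d : ℕ} (T : Theory d)

instance (e : Γ.Edge) : SigmaFinite (Γ.edgeMeasure T e) := by
  unfold edgeMeasure
  split_ifs <;> infer_instance

variable {Γ}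

theorem not_isHead_leg (i : Fin n) : ¬ Γ.IsHead (Γ.leg i) := by
  have h : Γ.pair (Γ.leg i) = Γ.leg i := (Γ.pair_eq_iff _).2 ⟨i, rfl⟩
  rintro (⟨h1, h2⟩ | ⟨-, h2⟩)
  · rw [h, h1] at h2
    exact absurd h2 (by decide)
  · exact absurd h2 (by simp [h])

theorem IsHead.not_pair {h : Fin H} (hh : Γ.IsHead h) : ¬ Γ.IsHead (Γ.pair h) := by
  unfold IsHead IsPlusMinus at *
  rw [Γ.pair_pair]
  rcases hh with ⟨h1, h2⟩ | ⟨h1, h2⟩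
  · rintro (⟨h3, h4⟩ | ⟨h3, -⟩)
    · rw [h2] at h3; exact absurd h3 (by decide)
    · rw [h1, h2] at h3; exact absurd h3 (by decide)
  · rintro (⟨h3, h4⟩ | ⟨-, h4⟩)
    · rw [h1, h3] at h4; exact absurd h4 (by decide)
    · exact absurd h4 h2.asymm

/-- The head of an internal edge is singled out by the types of its ends if they differ, and by the
order of the labels if they agree. With `IsHead.not_pair`, exactly one end of each edge is a head.
-/
theorem isHead_trichotomy (h : Fin H) :
    Γ.IsHead h ∨ Γ.IsHead (Γ.pair h) ∨ ∃ i, Γ.leg i = h := by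
  by_cases hp : Γ.pair h = h
  · exact Or.inr (Or.inr ((Γ.pair_eq_iff h).1 hp))
  · unfold IsHead IsPlusMinus
    rw [Γ.pair_pair]
    rcases Int.units_eq_one_or (Γ.sign (Γ.att h)) with h1 | h1 <;>
    rcases Int.units_eq_one_or (Γ.sign (Γ.att (Γ.pair h))) with h2 | h2 <;>
    rcases lt_or_gt_of_ne hp with h3 | h3 <;> simp [h1, h2, h3]

theorem mom_head (p : Fin n → Mom d) (q : Γ.Edge → Mom d) (e : Γ.Edge) :
    Γ.mom p q e.1 = q e := by
  unfold mom
  exact dif_pos e.2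

theorem mom_pair_head (p : Fin n → Mom d) (q : Γ.Edge → Mom d) (e : Γ.Edge) :
    Γ.mom p q (Γ.pair e.1) = -q e := by
  have h := e.2
  have h' := h.not_pair
  unfold mom
  rw [dif_neg h', dif_pos (by rwa [Γ.pair_pair])]
  congr 2
  exact Subtype.ext (Γ.pair_pair _)

theorem mom_leg (p : Fin n → Mom d) (q : Γ.Edge → Mom d) (i : Fin n) :
    Γ.mom p q (Γ.leg i) = p i := by
  unfold mom
  rw [dif_neg (not_isHead_leg i), dif_neg, Γ.leg_injective.extend_apply]
  rw [(Γ.pair_eq_iff _).2 ⟨i, rfl⟩]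
  exact not_isHead_leg i

/-- Momenta are determined by their values on representatives of edges, their antisymmetry on
edges, and their values on legs. -/
theorem mom_unique (p : Fin n → Mom d) (q : Γ.Edge → Mom d) (m : Fin H → Mom d)
    (hq : ∀ e : Γ.Edge, m e.1 = q e) (hpair : ∀ e : Γ.Edge, m (Γ.pair e.1) = -q e)
    (hp : ∀ i, m (Γ.leg i) = p i) (h : Fin H) : Γ.mom p q h = m h := by
  rcases isHead_trichotomy (Γ := Γ) h with hh | hh | ⟨i, rfl⟩
  · exact (mom_head p q ⟨h, hh⟩).trans (hq ⟨h, hh⟩).symm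
  · have h1 := mom_pair_head p q ⟨_, hh⟩
    have h2 := hpair ⟨_, hh⟩
    rw [Γ.pair_pair] at h1 h2
    rw [h1, h2]
  · rw [mom_leg, hp]

end Diagram

/-! ### Invariance of diagram integrals under isomorphism. -/

theorem measurePreserving_neg_mom (d : ℕ) :
    MeasurePreserving (MeasurableEquiv.neg (Mom d)) volume volume :=
  (Measure.measurePreserving_neg (volume : Measure ℝ)).prod
    (LinearIsometryEquiv.neg ℝ (E := SMom d)).measurePreserving

namespace Diagram

variable {n N H : ℕ} {ε : Fin n → ℤˣ} {Γ Δ : Diagram n N H ε} {d : ℕ} (T : Theory d)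

namespace IsIso

open Classical in
/-- The transformation of the momentum of an edge under an isomorphism of diagrams. -/
def flip (Δ : Diagram n N H ε) (φ : Equiv.Perm (Fin N) × Equiv.Perm (Fin H)) (d : ℕ) (h : Fin H) :
    Mom d ≃ᵐ Mom d :=
  if Δ.IsHead (φ.2 h) then MeasurableEquiv.refl _ else MeasurableEquiv.neg _

variable {φ : Equiv.Perm (Fin N) × Equiv.Perm (Fin H)} (hφ : IsIso Γ Δ φ)

include hφ

theorem sign_att (h : Fin H) : Δ.sign (Δ.att (φ.2 h)) = Γ.sign (Γ.att h) := by
  rw [hφ.2.1, hφ.1]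

theorem sign_att_pair (h : Fin H) :
    Δ.sign (Δ.att (Δ.pair (φ.2 h))) = Γ.sign (Γ.att (Γ.pair h)) := by
  rw [hφ.2.2.1, hφ.sign_att]

theorem isPlusMinus_iff (h : Fin H) : Δ.IsPlusMinus (φ.2 h) ↔ Γ.IsPlusMinus h := by
  unfold IsPlusMinus
  rw [hφ.sign_att, hφ.sign_att_pair]

theorem connected_iff : Γ.Connected ↔ Δ.Connected := by
  refine SimpleGraph.Iso.connected_iff (⟨φ.1, ?_⟩ : Γ.graph ≃g Δ.graph)
  intro a b
  have key : ∀ a b, (∃ h, Δ.att h = φ.1 a ∧ Δ.att (Δ.pair h) = φ.1 b) ↔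
      ∃ h, Γ.att h = a ∧ Γ.att (Γ.pair h) = b := fun a b => by
    rw [φ.2.surjective.exists]
    simp [hφ.2.1, hφ.2.2.1]
  simp only [graph, SimpleGraph.fromRel_adj, key, ne_eq, EmbeddingLike.apply_eq_iff_eq]

theorem graphWithout_connected_iff (e : Fin H) :
    (Γ.graphWithout e).Connected ↔ (Δ.graphWithout (φ.2 e)).Connected := by
  refine SimpleGraph.Iso.connected_iff (⟨φ.1, ?_⟩ : Γ.graphWithout e ≃g Δ.graphWithout (φ.2 e))
  intro a b
  have key : ∀ a b, (∃ h, h ≠ φ.2 e ∧ h ≠ Δ.pair (φ.2 e) ∧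
      Δ.att h = φ.1 a ∧ Δ.att (Δ.pair h) = φ.1 b) ↔
      ∃ h, h ≠ e ∧ h ≠ Γ.pair e ∧ Γ.att h = a ∧ Γ.att (Γ.pair h) = b := fun a b => by
    rw [φ.2.surjective.exists]
    simp [hφ.2.1, hφ.2.2.1]
  simp only [graphWithout, SimpleGraph.fromRel_adj, key, ne_eq, EmbeddingLike.apply_eq_iff_eq]

theorem card_nonSepPM : Γ.nonSepPM.card = Δ.nonSepPM.card := by
  refine Finset.card_equiv φ.2 fun e => ?_
  simp [nonSepPM, hφ.isPlusMinus_iff, hφ.graphWithout_connected_iff e]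

theorem isHead_or (e : Γ.Edge) : Δ.IsHead (φ.2 e.1) ∨ Δ.IsHead (Δ.pair (φ.2 e.1)) := by
  rcases isHead_trichotomy (Γ := Δ) (φ.2 e.1) with h | h | ⟨i, hi⟩
  · exact Or.inl h
  · exact Or.inr h
  · rw [hφ.2.2.2 i] at hi
    exact absurd (φ.2.injective hi ▸ e.2) (not_isHead_leg i)

open Classical in
/-- The action of an isomorphism of diagrams on edges. -/
def edgeMap (e : Γ.Edge) : Δ.Edge :=
  if h : Δ.IsHead (φ.2 e.1) then ⟨φ.2 e.1, h⟩
  else ⟨Δ.pair (φ.2 e.1), (hφ.isHead_or e).resolve_left h⟩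

theorem edgeMap_of_isHead (e : Γ.Edge) (h : Δ.IsHead (φ.2 e.1)) :
    (hφ.edgeMap e).1 = φ.2 e.1 := by
  simp [edgeMap, h]

theorem edgeMap_of_not_isHead (e : Γ.Edge) (h : ¬ Δ.IsHead (φ.2 e.1)) :
    (hφ.edgeMap e).1 = Δ.pair (φ.2 e.1) := by
  simp [edgeMap, h]

theorem edgeMap_bijective : Function.Bijective hφ.edgeMap := by
  constructor
  · intro e e' he
    have he : (hφ.edgeMap e).1 = (hφ.edgeMap e').1 := congrArg Subtype.val he
    -- Edges with the same image share a half-edge up to `pair`; the two ends of one edge cannot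
    -- both be heads, which excludes the second case.
    have key : e.1 = e'.1 ∨ e.1 = Γ.pair e'.1 := by
      by_cases h : Δ.IsHead (φ.2 e.1) <;> by_cases h' : Δ.IsHead (φ.2 e'.1)
      · rw [hφ.edgeMap_of_isHead e h, hφ.edgeMap_of_isHead e' h'] at he
        exact Or.inl (φ.2.injective he)
      · rw [hφ.edgeMap_of_isHead e h, hφ.edgeMap_of_not_isHead e' h', hφ.2.2.1] at he
        exact Or.inr (φ.2.injective he)
      · rw [hφ.edgeMap_of_not_isHead e h, hφ.edgeMap_of_isHead e' h', hφ.2.2.1] at he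
        exact Or.inr (by rw [← φ.2.injective he, Γ.pair_pair])
      · rw [hφ.edgeMap_of_not_isHead e h, hφ.edgeMap_of_not_isHead e' h', hφ.2.2.1,
          hφ.2.2.1] at he
        have := congrArg Γ.pair (φ.2.injective he)
        rw [Γ.pair_pair, Γ.pair_pair] at this
        exact Or.inl this
    rcases key with h | h
    · exact Subtype.ext h
    · exact absurd (h ▸ e.2) e'.2.not_pair
  · intro f
    obtain ⟨h, hf⟩ := φ.2.surjective f.1
    rcases isHead_trichotomy (Γ := Γ) h with hh | hh | ⟨i, rfl⟩
    · refine ⟨⟨h, hh⟩, Subtype.ext ?_⟩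
      exact (hφ.edgeMap_of_isHead ⟨h, hh⟩ (hf ▸ f.2)).trans hf
    · refine ⟨⟨_, hh⟩, Subtype.ext ?_⟩
      -- Here `h` is the end that is not a head. The head `Γ.pair h` goes to the partner of `f`,
      -- which is not a head, so `edgeMap` switches back to `f`.
      have h1 : φ.2 (Γ.pair h) = Δ.pair f.1 := by rw [← hφ.2.2.1, hf]
      refine (hφ.edgeMap_of_not_isHead ⟨_, hh⟩ (h1 ▸ f.2.not_pair)).trans ?_
      exact (congrArg Δ.pair h1).trans (Δ.pair_pair _)
    · rw [← hφ.2.2.2 i] at hf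
      exact absurd (hf ▸ f.2) (not_isHead_leg i)

/-- The bijection between edges induced by an isomorphism of diagrams. -/
def edgeEquiv : Γ.Edge ≃ Δ.Edge := Equiv.ofBijective _ hφ.edgeMap_bijective

/-- The head of a `+-` edge is fixed by vertex types, which isomorphisms preserve. Hence only `++`
and `--` edges can be reversed: their propagators are even and Lebesgue measure is invariant under
negation, whereas the shell measure need not be. -/
theorem not_isPlusMinus_of_not_isHead {h : Fin H} (hh : ¬ Δ.IsHead (φ.2 h)) :
    ¬ Γ.IsPlusMinus h := fun hpm => hh (Or.inl ((hφ.isPlusMinus_iff h).2 hpm))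

theorem isPlusMinus_edgeMap_iff (e : Γ.Edge) :
    Δ.IsPlusMinus (hφ.edgeMap e).1 ↔ Γ.IsPlusMinus e.1 := by
  by_cases h : Δ.IsHead (φ.2 e.1)
  · rw [hφ.edgeMap_of_isHead e h, hφ.isPlusMinus_iff]
  · have h1 := hφ.not_isPlusMinus_of_not_isHead h
    rw [hφ.edgeMap_of_not_isHead e h, hφ.2.2.1, hφ.isPlusMinus_iff]
    have h2 := e.2.resolve_left h1
    refine iff_of_false (fun hpm => ?_) h1
    unfold IsPlusMinus at hpm
    rw [Γ.pair_pair, h2.1, hpm.1] at hpm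
    exact absurd hpm.2 (by decide)

theorem flip_eq_mom (p : Fin n → Mom d) (q : Δ.Edge → Mom d) (e : Γ.Edge) :
    flip Δ φ d e.1 (q (hφ.edgeMap e)) = Δ.mom p q (φ.2 e.1) := by
  rw [← mom_head p q]
  by_cases h : Δ.IsHead (φ.2 e.1)
  · simp [flip, h, hφ.edgeMap_of_isHead e h]
  · have h1 := mom_pair_head p q (hφ.edgeMap e)
    have h2 := hφ.edgeMap_of_not_isHead e h
    rw [h2, Δ.pair_pair] at h1
    rw [mom_head, h1]
    simp [flip, h]

theorem measurePreserving_flip (e : Γ.Edge) :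
    MeasurePreserving (flip Δ φ d e.1) (Δ.edgeMeasure T (hφ.edgeEquiv e)) (Γ.edgeMeasure T e) := by
  have h0 : Δ.edgeMeasure T (hφ.edgeEquiv e) = Γ.edgeMeasure T e := by
    unfold edgeMeasure
    rw [show hφ.edgeEquiv e = hφ.edgeMap e from rfl, hφ.isPlusMinus_edgeMap_iff]
  rw [h0]
  by_cases h : Δ.IsHead (φ.2 e.1)
  · simp only [flip, h, if_true]
    exact MeasurePreserving.id _
  · have h1 := hφ.not_isPlusMinus_of_not_isHead h
    simp only [flip, h, if_false, edgeMeasure, h1]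
    exact measurePreserving_neg_mom d

theorem edgeFactor_flip (η : ℝ) (e : Γ.Edge) (x : Mom d) :
    Γ.edgeFactor T η e (flip Δ φ d e.1 x) = Δ.edgeFactor T η (hφ.edgeMap e) x := by
  have h0 := hφ.isPlusMinus_edgeMap_iff e
  unfold edgeFactor
  rw [h0]
  by_cases h : Δ.IsHead (φ.2 e.1)
  · rw [hφ.edgeMap_of_isHead e h, hφ.sign_att]
    simp [flip, h]
  · have h1 := hφ.not_isPlusMinus_of_not_isHead h
    rw [hφ.edgeMap_of_not_isHead e h, hφ.sign_att_pair, ← (e.2.resolve_left h1).1]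
    simp [flip, h, h1, T.Gpp_neg, T.Gmm_neg]

/-- Transporting `Δ.mom` along `φ` gives an assignment that is antisymmetric on edges and has the
right values on heads and legs, so `mom_unique` applies. -/
theorem mom_eq (p : Fin n → Mom d) (q : Δ.Edge → Mom d) (h : Fin H) :
    Γ.mom p (fun e => flip Δ φ d e.1 (q (hφ.edgeMap e))) h = Δ.mom p q (φ.2 h) := by
  refine mom_unique p _ (fun h => Δ.mom p q (φ.2 h)) (fun e => ?_) (fun e => ?_) (fun i => ?_) h
  · exact (hφ.flip_eq_mom p q e).symm
  · rw [hφ.flip_eq_mom p q e, ← hφ.2.2.1]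
    rcases hφ.isHead_or e with hh | hh
    · rw [mom_pair_head p q ⟨_, hh⟩, mom_head p q ⟨_, hh⟩]
    · have := mom_pair_head p q ⟨_, hh⟩
      rw [Δ.pair_pair] at this
      rw [this, mom_head p q ⟨_, hh⟩, neg_neg]
  · rw [← hφ.2.2.2, mom_leg]

theorem momAt_eq (p : Fin n → Mom d) (q : Δ.Edge → Mom d) (v : Fin N) :
    Γ.momAt p (fun e => flip Δ φ d e.1 (q (hφ.edgeMap e))) v = Δ.momAt p q (φ.1 v) := by
  classical
  have h1 : (Finset.univ.filter fun h => Δ.att h = φ.1 v) =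
      (Finset.univ.filter fun h => Γ.att h = v).map φ.2.toEmbedding := by
    ext h
    obtain ⟨h, rfl⟩ := φ.2.surjective h
    simp [hφ.2.1]
  unfold momAt
  rw [h1, Finset.map_val, Multiset.map_map]
  exact Multiset.map_congr rfl fun h _ => hφ.mom_eq p q h

theorem integrand_eq (η : ℝ) (p : Fin n → Mom d) (q : Δ.Edge → Mom d) :
    Γ.integrand T η p (fun e => flip Δ φ d e.1 (q (hφ.edgeEquiv e))) = Δ.integrand T η p q := by
  unfold integrand
  congr 1
  · exact Fintype.prod_equiv hφ.edgeEquiv _ _ fun e => hφ.edgeFactor_flip T η e _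
  · refine Fintype.prod_equiv φ.1 _ _ fun v => ?_
    rw [hφ.1, ← hφ.momAt_eq]
    rfl

/-- The change of variables is a measure-preserving measurable equivalence, so the equality needs no
convergence; divergent integrals have the value 0 on both sides. -/
theorem contribution_eq (η : ℝ) (p : Fin n → T.Shell) :
    Γ.contribution T η p = Δ.contribution T η p := by
  unfold contribution
  rw [← integral_pi_reindex hφ.edgeEquiv (Γ.edgeMeasure T) (Δ.edgeMeasure T)
    (fun e => flip Δ φ d e.1) (hφ.measurePreserving_flip T)]
  exact integral_congr_ae (Eventually.of_forall fun q => hφ.integrand_eq T η _ q)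

end IsIso

/-! ### Relabellings, orbits and symmetry factors. -/

/-- Relabelling of vertices and half-edges. -/
def relabel (φ : Equiv.Perm (Fin N) × Equiv.Perm (Fin H)) (Γ : Diagram n N H ε) :
    Diagram n N H ε where
  sign v := Γ.sign (φ.1⁻¹ v)
  att h := φ.1 (Γ.att (φ.2⁻¹ h))
  pair h := φ.2 (Γ.pair (φ.2⁻¹ h))
  leg i := φ.2 (Γ.leg i)
  pair_pair h := by simp [Γ.pair_pair]
  leg_injective := φ.2.injective.comp Γ.leg_injective
  pair_eq_iff h := by
    obtain ⟨h, rfl⟩ := φ.2.surjective h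
    simp [Γ.pair_eq_iff]
  sign_leg i := by simp [Γ.sign_leg]

theorem isIso_iff_relabel (φ : Equiv.Perm (Fin N) × Equiv.Perm (Fin H)) :
    IsIso Γ Δ φ ↔ relabel φ Γ = Δ := by
  constructor
  · rintro ⟨h1, h2, h3, h4⟩
    refine Diagram.ext (funext fun v => ?_) (funext fun h => ?_) (funext fun h => ?_)
      (funext fun i => (h4 i).symm)
    · obtain ⟨v, rfl⟩ := φ.1.surjective v
      simp [relabel, h1]
    · obtain ⟨h, rfl⟩ := φ.2.surjective h
      simp [relabel, h2]
    · obtain ⟨h, rfl⟩ := φ.2.surjective h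
      simp [relabel, h3]
  · rintro rfl
    simp [IsIso, relabel]

theorem isIso_relabel (φ : Equiv.Perm (Fin N) × Equiv.Perm (Fin H)) :
    IsIso Γ (relabel φ Γ) φ := (isIso_iff_relabel φ).2 rfl

instance : MulAction (Equiv.Perm (Fin N) × Equiv.Perm (Fin H))
    {Γ : Diagram n N H ε // Γ.Connected} where
  smul φ Γ := ⟨relabel φ Γ.1, (isIso_relabel φ).connected_iff.1 Γ.2⟩
  one_smul _ := rfl
  mul_smul _ _ _ := rfl

/-- Consequently isomorphism classes are orbits and automorphism groups are stabilizers. -/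
theorem isIso_iff_smul (φ : Equiv.Perm (Fin N) × Equiv.Perm (Fin H))
    (Γ Δ : {Γ : Diagram n N H ε // Γ.Connected}) : IsIso Γ.1 Δ.1 φ ↔ φ • Γ = Δ := by
  rw [isIso_iff_relabel, Subtype.ext_iff]
  rfl

instance : Fintype {Γ : Diagram n N H ε // Γ.Connected} := Fintype.ofFinite _

/-- The isomorphism class of a connected diagram. -/
def _root_.Keldysh.DiagramClass.mk (Γ : {Γ : Diagram n N H ε // Γ.Connected}) :
    DiagramClass n N H ε := Quotient.mk (connSetoid n N H ε) Γ

theorem _root_.Keldysh.DiagramClass.mk_eq_iff {Γ : {Γ : Diagram n N H ε // Γ.Connected}}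
    {c : DiagramClass n N H ε} : DiagramClass.mk Γ = c ↔ ∃ φ, IsIso c.rep Γ.1 φ :=
  eq_comm.trans Quotient.eq_mk_iff_out

/-- The number of labellings of a diagram, by the orbit-stabilizer theorem. -/
theorem card_class_mul_symm (c : DiagramClass n N H ε) :
    Nat.card {Γ : {Γ : Diagram n N H ε // Γ.Connected} // DiagramClass.mk Γ = c} *
      c.rep.symm = Nat.card (Equiv.Perm (Fin N) × Equiv.Perm (Fin H)) := by
  classical
  have key := MulAction.card_orbit_mul_card_stabilizer_eq_card_group
    (Equiv.Perm (Fin N) × Equiv.Perm (Fin H)) (Quotient.out c)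
  simp only [← Nat.card_eq_fintype_card] at key
  rw [← key]
  congr 1
  · refine Nat.card_congr (Equiv.subtypeEquivRight fun Γ => ?_)
    rw [MulAction.mem_orbit_iff]
    simp only [← isIso_iff_smul]
    exact DiagramClass.mk_eq_iff
  · exact Nat.card_congr (Equiv.subtypeEquivRight fun φ => isIso_iff_smul φ _ _)

/-- A sum over isomorphism classes weighted by inverse symmetry factors is a sum over labelled
diagrams divided by the number of relabellings. -/
theorem sum_class_div_symm (f : Diagram n N H ε → ℂ)
    (hf : ∀ Γ Δ φ, IsIso Γ Δ φ → f Γ = f Δ) :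
    ∑ c : DiagramClass n N H ε, f c.rep / c.rep.symm =
      (∑ Γ : {Γ : Diagram n N H ε // Γ.Connected}, f Γ.1) /
        Nat.card (Equiv.Perm (Fin N) × Equiv.Perm (Fin H)) := by
  classical
  rw [← Finset.sum_fiberwise (κ := DiagramClass n N H ε) Finset.univ
    DiagramClass.mk, Finset.sum_div]
  refine Finset.sum_congr rfl fun c _ => ?_
  have hG : (Nat.card (Equiv.Perm (Fin N) × Equiv.Perm (Fin H)) : ℂ) ≠ 0 :=
    Nat.cast_ne_zero.2 Nat.card_pos.ne'
  have hc := card_class_mul_symm c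
  have hfib : ∑ Γ ∈ Finset.univ.filter
      (fun Γ => DiagramClass.mk Γ = c), f Γ.1 =
      Nat.card {Γ : {Γ : Diagram n N H ε // Γ.Connected} // DiagramClass.mk Γ = c} * f c.rep := by
    rw [Finset.sum_congr rfl (g := fun _ => f c.rep), Finset.sum_const, nsmul_eq_mul,
      Nat.card_eq_fintype_card, Fintype.card_subtype]
    intro Γ hΓ
    obtain ⟨φ, hφ⟩ := DiagramClass.mk_eq_iff.1 (Finset.mem_filter.1 hΓ).2
    exact (hf _ _ φ hφ).symm
  rw [hfib]
  -- The group order is the size of the class times the symmetry factor; being nonzero, it has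
  -- nonzero factors, so the size of the class cancels.
  rw [← hc, Nat.cast_mul] at hG ⊢
  rw [mul_div_mul_left _ _ (left_ne_zero_of_mul hG)]

end Diagram

namespace Diagram

/-! ### Joining two legs and cutting an edge as inverse operations. -/

section Glue

variable {n N H : ℕ} {ε : Fin n → ℤˣ} (Δ : Diagram (n + 2) N H (Fin.append ε ![1, -1]))

/-- The last but one leg, of type `+`. -/
def plusLeg : Fin H := Δ.leg (Fin.natAdd n 0)

/-- The last leg, of type `-`. -/
def minusLeg : Fin H := Δ.leg (Fin.natAdd n 1)

theorem sign_plusLeg : Δ.sign (Δ.att Δ.plusLeg) = 1 := by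
  rw [plusLeg, Δ.sign_leg, Fin.append_right]; rfl

theorem sign_minusLeg : Δ.sign (Δ.att Δ.minusLeg) = -1 := by
  rw [minusLeg, Δ.sign_leg, Fin.append_right]; rfl

theorem pair_plusLeg : Δ.pair Δ.plusLeg = Δ.plusLeg := (Δ.pair_eq_iff _).2 ⟨_, rfl⟩

theorem pair_minusLeg : Δ.pair Δ.minusLeg = Δ.minusLeg := (Δ.pair_eq_iff _).2 ⟨_, rfl⟩

theorem plusLeg_ne_minusLeg : Δ.plusLeg ≠ Δ.minusLeg := fun h => by
  have := Δ.sign_plusLeg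
  rw [h, Δ.sign_minusLeg] at this
  exact absurd this (by decide)

theorem leg_castAdd_ne_plusLeg (i : Fin n) : Δ.leg (Fin.castAdd 2 i) ≠ Δ.plusLeg := fun h => by
  have := congrArg Fin.val (Δ.leg_injective h)
  simp at this
  omega

theorem leg_castAdd_ne_minusLeg (i : Fin n) : Δ.leg (Fin.castAdd 2 i) ≠ Δ.minusLeg := fun h => by
  have := congrArg Fin.val (Δ.leg_injective h)
  simp at this
  omega

theorem exists_leg_iff (h : Fin H) : (∃ i, Δ.leg i = h) ↔
    (∃ i, Δ.leg (Fin.castAdd 2 i) = h) ∨ h = Δ.plusLeg ∨ h = Δ.minusLeg := by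
  constructor
  · rintro ⟨i, rfl⟩
    induction i using Fin.addCases with
    | left i => exact Or.inl ⟨i, rfl⟩
    | right j =>
      fin_cases j
      · exact Or.inr (Or.inl rfl)
      · exact Or.inr (Or.inr rfl)
  · rintro (⟨i, rfl⟩ | rfl | rfl) <;> exact ⟨_, rfl⟩

theorem pair_eq_plusLeg_iff (h : Fin H) : Δ.pair h = Δ.plusLeg ↔ h = Δ.plusLeg :=
  ⟨fun hh => by rw [← Δ.pair_pair h, hh, Δ.pair_plusLeg], fun hh => by rw [hh, Δ.pair_plusLeg]⟩

theorem pair_eq_minusLeg_iff (h : Fin H) : Δ.pair h = Δ.minusLeg ↔ h = Δ.minusLeg :=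
  ⟨fun hh => by rw [← Δ.pair_pair h, hh, Δ.pair_minusLeg], fun hh => by rw [hh, Δ.pair_minusLeg]⟩

/-- The pairing of half-edges in which the last two legs are joined. -/
def gluePair (h : Fin H) : Fin H :=
  if h = Δ.plusLeg then Δ.minusLeg else if h = Δ.minusLeg then Δ.plusLeg else Δ.pair h

theorem gluePair_plusLeg : Δ.gluePair Δ.plusLeg = Δ.minusLeg := if_pos rfl

theorem gluePair_minusLeg : Δ.gluePair Δ.minusLeg = Δ.plusLeg := by
  simp [gluePair, Δ.plusLeg_ne_minusLeg.symm]

theorem gluePair_of_ne {h : Fin H} (h1 : h ≠ Δ.plusLeg) (h2 : h ≠ Δ.minusLeg) :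
    Δ.gluePair h = Δ.pair h := by
  simp [gluePair, h1, h2]

/-- The diagram obtained by joining the last two legs into a `+-` edge. -/
def glue : Diagram n N H ε where
  sign := Δ.sign
  att := Δ.att
  pair := Δ.gluePair
  leg i := Δ.leg (Fin.castAdd 2 i)
  pair_pair h := by
    by_cases h1 : h = Δ.plusLeg
    · rw [h1, gluePair_plusLeg, gluePair_minusLeg]
    by_cases h2 : h = Δ.minusLeg
    · rw [h2, gluePair_minusLeg, gluePair_plusLeg]
    rw [Δ.gluePair_of_ne h1 h2, Δ.gluePair_of_ne, Δ.pair_pair]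
    · rwa [Ne, pair_eq_plusLeg_iff]
    · rwa [Ne, pair_eq_minusLeg_iff]
  leg_injective := Δ.leg_injective.comp (Fin.castAdd_injective n 2)
  pair_eq_iff h := by
    by_cases h1 : h = Δ.plusLeg
    · subst h1
      rw [gluePair_plusLeg]
      exact iff_of_false Δ.plusLeg_ne_minusLeg.symm
        fun ⟨i, hi⟩ => Δ.leg_castAdd_ne_plusLeg i hi
    by_cases h2 : h = Δ.minusLeg
    · subst h2
      rw [gluePair_minusLeg]
      exact iff_of_false Δ.plusLeg_ne_minusLeg
        fun ⟨i, hi⟩ => Δ.leg_castAdd_ne_minusLeg i hi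
    rw [Δ.gluePair_of_ne h1 h2, Δ.pair_eq_iff, exists_leg_iff]
    simp [h1, h2]
  sign_leg i := by rw [Δ.sign_leg, Fin.append_left]

theorem glue_pair_plusLeg : Δ.glue.pair Δ.plusLeg = Δ.minusLeg := Δ.gluePair_plusLeg

theorem glue_pair_minusLeg : Δ.glue.pair Δ.minusLeg = Δ.plusLeg := Δ.gluePair_minusLeg

theorem glue_pair_of_ne {h : Fin H} (h1 : h ≠ Δ.plusLeg) (h2 : h ≠ Δ.minusLeg) :
    Δ.glue.pair h = Δ.pair h := Δ.gluePair_of_ne h1 h2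

theorem isPlusMinus_glue_plusLeg : Δ.glue.IsPlusMinus Δ.plusLeg := by
  refine ⟨Δ.sign_plusLeg, ?_⟩
  rw [glue_pair_plusLeg]
  exact Δ.sign_minusLeg

/-- Joining alters the pairing only at the last two legs, neither of which was a head; of these the
`+` end becomes one. -/
theorem isHead_glue_iff (h : Fin H) : Δ.glue.IsHead h ↔ h = Δ.plusLeg ∨ Δ.IsHead h := by
  have hp := Δ.isPlusMinus_glue_plusLeg
  by_cases h1 : h = Δ.plusLeg
  · subst h1
    exact iff_of_true (Or.inl hp) (Or.inl rfl)
  by_cases h2 : h = Δ.minusLeg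
  · subst h2
    have := IsHead.not_pair (Γ := Δ.glue) (Or.inl hp)
    rw [glue_pair_plusLeg] at this
    exact iff_of_false this (by rintro (h | h); exacts [h1 h, not_isHead_leg _ h])
  · simp only [h1, false_or]
    unfold IsHead IsPlusMinus
    rw [Δ.glue_pair_of_ne h1 h2]
    rfl

theorem IsHead.ne_plusLeg {h : Fin H} (hh : Δ.IsHead h) : h ≠ Δ.plusLeg := by
  rintro rfl
  exact not_isHead_leg _ hh

theorem IsHead.ne_minusLeg {h : Fin H} (hh : Δ.IsHead h) : h ≠ Δ.minusLeg := by
  rintro rfl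
  exact not_isHead_leg _ hh

theorem isPlusMinus_glue_iff {h : Fin H} (hh : Δ.IsHead h) :
    Δ.glue.IsPlusMinus h ↔ Δ.IsPlusMinus h := by
  unfold IsPlusMinus
  rw [Δ.glue_pair_of_ne (IsHead.ne_plusLeg Δ hh) (IsHead.ne_minusLeg Δ hh)]
  rfl

/-- This translates "non-separating" into "connected after cutting". The half-edges of the removed
edge are legs of `Δ`, fixed by `pair`, so in `Δ.graph` they could contribute only self-loops, which
`fromRel` discards. -/
theorem graphWithout_glue : Δ.glue.graphWithout Δ.plusLeg = Δ.graph := by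
  have key : ∀ a b, a ≠ b → ((∃ h, h ≠ Δ.plusLeg ∧ h ≠ Δ.glue.pair Δ.plusLeg ∧
      Δ.glue.att h = a ∧ Δ.glue.att (Δ.glue.pair h) = b) ↔
      ∃ h, Δ.att h = a ∧ Δ.att (Δ.pair h) = b) := by
    intro a b hab
    rw [glue_pair_plusLeg]
    constructor
    · rintro ⟨h, h1, h2, h3, h4⟩
      rw [Δ.glue_pair_of_ne h1 h2] at h4
      exact ⟨h, h3, h4⟩
    · rintro ⟨h, h3, h4⟩
      have h1 : h ≠ Δ.plusLeg := by
        rintro rfl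
        rw [pair_plusLeg] at h4
        exact hab (h3.symm.trans h4)
      have h2 : h ≠ Δ.minusLeg := by
        rintro rfl
        rw [pair_minusLeg] at h4
        exact hab (h3.symm.trans h4)
      refine ⟨h, h1, h2, h3, ?_⟩
      rw [Δ.glue_pair_of_ne h1 h2]
      exact h4
  ext a b
  unfold graphWithout graph
  rw [SimpleGraph.fromRel_adj, SimpleGraph.fromRel_adj]
  exact and_congr_right fun hab => or_congr (key a b hab) (key b a hab.symm)

theorem graphWithout_le (Γ : Diagram n N H ε) (e : Fin H) : Γ.graphWithout e ≤ Γ.graph := by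
  intro a b hab
  unfold graphWithout at hab
  unfold graph
  rw [SimpleGraph.fromRel_adj] at hab ⊢
  refine ⟨hab.1, hab.2.imp ?_ ?_⟩ <;>
  · rintro ⟨h, -, -, h3⟩
    exact ⟨h, h3⟩

variable {Δ}

theorem Connected.plusLeg_mem_nonSepPM (hΔ : Δ.Connected) : Δ.plusLeg ∈ Δ.glue.nonSepPM := by
  classical
  simp only [nonSepPM, Finset.mem_filter, Finset.mem_univ, true_and, graphWithout_glue]
  exact ⟨Δ.isPlusMinus_glue_plusLeg, hΔ⟩

theorem Connected.glue (hΔ : Δ.Connected) : Δ.glue.Connected :=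
  SimpleGraph.Connected.mono (graphWithout_le Δ.glue Δ.plusLeg) (by rwa [graphWithout_glue])

/-- Two diagrams agree if they agree after joining their last two legs and the `+` ends of the new
edges agree. -/
theorem glue_injective {Δ Δ' : Diagram (n + 2) N H (Fin.append ε ![1, -1])}
    (h : Δ.glue = Δ'.glue) (hleg : Δ.plusLeg = Δ'.plusLeg) : Δ = Δ' := by
  -- The `-` leg is recovered as the partner of the `+` leg in the joined diagram.
  have hm : Δ.minusLeg = Δ'.minusLeg := by
    rw [← glue_pair_plusLeg, ← glue_pair_plusLeg, h, hleg]
  have hs : Δ.glue.sign = Δ'.glue.sign := congrArg _ h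
  have ha : Δ.glue.att = Δ'.glue.att := congrArg _ h
  refine Diagram.ext hs ha (funext fun x => ?_)
    (funext fun i => ?_)
  · by_cases h1 : x = Δ.plusLeg
    · rw [h1, pair_plusLeg, hleg, pair_plusLeg]
    by_cases h2 : x = Δ.minusLeg
    · rw [h2, pair_minusLeg, hm, pair_minusLeg]
    rw [← Δ.glue_pair_of_ne h1 h2, h, Δ'.glue_pair_of_ne (hleg ▸ h1) (hm ▸ h2)]
  · induction i using Fin.addCases with
    | left i => exact congrFun (congrArg Diagram.leg h) i
    | right j =>
      fin_cases j
      · exact hleg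
      · exact hm

/-- The diagram obtained by cutting a `+-` edge, given by its `+` end. -/
def cut (Γ : Diagram n N H ε) (e : Fin H) (he : Γ.IsPlusMinus e) :
    Diagram (n + 2) N H (Fin.append ε ![1, -1]) where
  sign := Γ.sign
  att := Γ.att
  pair h := if h = e ∨ h = Γ.pair e then h else Γ.pair h
  leg := Fin.append Γ.leg ![e, Γ.pair e]
  pair_pair h := by
    by_cases h1 : h = e ∨ h = Γ.pair e
    · simp only [h1, if_true]
    · have h2 : ¬ (Γ.pair h = e ∨ Γ.pair h = Γ.pair e) := by
        rintro (h2 | h2)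
        · exact h1 (Or.inr (by rw [← h2, Γ.pair_pair]))
        · exact h1 (Or.inl (by rw [← Γ.pair_pair h, h2, Γ.pair_pair]))
      simp only [h1, h2, if_false, Γ.pair_pair]
  leg_injective := by
    have hne : e ≠ Γ.pair e := fun h => by
      have := he.2
      rw [← h, he.1] at this
      exact absurd this (by decide)
    have hleg : ∀ i, Γ.leg i ≠ e ∧ Γ.leg i ≠ Γ.pair e := by
      refine fun i => ⟨fun h => ?_, fun h => ?_⟩
      · exact hne ((Γ.pair_eq_iff e).2 ⟨i, h⟩).symm
      · have := (Γ.pair_eq_iff (Γ.pair e)).2 ⟨i, h⟩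
        rw [Γ.pair_pair] at this
        exact hne this
    rw [Fin.append_injective_iff]
    refine ⟨Γ.leg_injective, fun i j hij => ?_, fun i j => ?_⟩
    · fin_cases i <;> fin_cases j <;> simp_all
    · fin_cases j
      · exact (hleg i).1
      · exact (hleg i).2
  pair_eq_iff h := by
    have hex : (∃ i, Fin.append Γ.leg ![e, Γ.pair e] i = h) ↔
        (∃ i, Γ.leg i = h) ∨ (h = e ∨ h = Γ.pair e) := by
      constructor
      · rintro ⟨i, rfl⟩
        induction i using Fin.addCases with
        | left i => exact Or.inl ⟨i, by rw [Fin.append_left]⟩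
        | right j => fin_cases j <;> simp
      · rintro (⟨i, rfl⟩ | rfl | rfl)
        · exact ⟨Fin.castAdd 2 i, Fin.append_left _ _ _⟩
        · exact ⟨Fin.natAdd n 0, Fin.append_right _ _ _⟩
        · exact ⟨Fin.natAdd n 1, Fin.append_right _ _ _⟩
    rw [hex, ← Γ.pair_eq_iff]
    by_cases h1 : h = e ∨ h = Γ.pair e
    · simp only [h1, if_true, or_true]
    · simp only [h1, if_false, or_false]
  sign_leg i := by
    induction i using Fin.addCases with
    | left i => rw [Fin.append_left, Fin.append_left, Γ.sign_leg]
    | right j =>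
      rw [Fin.append_right, Fin.append_right]
      fin_cases j
      · exact he.1
      · exact he.2

theorem plusLeg_cut (Γ : Diagram n N H ε) (e : Fin H) (he : Γ.IsPlusMinus e) :
    (Γ.cut e he).plusLeg = e := Fin.append_right _ _ _

theorem minusLeg_cut (Γ : Diagram n N H ε) (e : Fin H) (he : Γ.IsPlusMinus e) :
    (Γ.cut e he).minusLeg = Γ.pair e := Fin.append_right _ _ _

theorem glue_cut (Γ : Diagram n N H ε) (e : Fin H) (he : Γ.IsPlusMinus e) :
    (Γ.cut e he).glue = Γ := by
  refine Diagram.ext rfl rfl (funext fun h => ?_) (funext fun i => Fin.append_left _ _ _)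
  have hp := plusLeg_cut Γ e he
  have hm := minusLeg_cut Γ e he
  by_cases h1 : h = e
  · subst h1
    have := glue_pair_plusLeg (Γ.cut h he)
    rwa [hp, hm] at this
  by_cases h2 : h = Γ.pair e
  · subst h2
    have := glue_pair_minusLeg (Γ.cut e he)
    rw [hp, hm] at this
    rw [this, Γ.pair_pair]
  · rw [glue_pair_of_ne _ (by rwa [hp]) (by rwa [hm])]
    simp [cut, h1, h2]

/-- A sum over connected diagrams with a chosen non-separating `+-` edge is a sum over the connected
diagrams with two more legs that result from cutting this edge. -/
theorem sum_nonSepPM (f : Diagram n N H ε → ℂ) :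
    ∑ Γ : {Γ : Diagram n N H ε // Γ.Connected}, ∑ _e ∈ Γ.1.nonSepPM, f Γ.1 =
      ∑ Δ : {Δ : Diagram (n + 2) N H (Fin.append ε ![1, -1]) // Δ.Connected}, f Δ.1.glue := by
  classical
  rw [Finset.sum_sigma']
  symm
  -- Joining remembers the new edge by its `+` end; `glue_injective` gives injectivity and `cut` the
  -- preimages.
  refine Finset.sum_bij (fun Δ _ => ⟨⟨Δ.1.glue, Δ.2.glue⟩, Δ.1.plusLeg⟩) ?_ ?_ ?_ ?_
  · intro Δ _
    exact Finset.mem_sigma.2 ⟨Finset.mem_univ _, Δ.2.plusLeg_mem_nonSepPM⟩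
  · intro Δ _ Δ' _ h
    simp only [Sigma.mk.injEq, Subtype.mk.injEq, heq_eq_eq] at h
    exact Subtype.ext (glue_injective h.1 h.2)
  · rintro ⟨⟨Γ, hΓ⟩, e⟩ he
    have he := (Finset.mem_sigma.1 he).2
    simp only [nonSepPM, Finset.mem_filter, Finset.mem_univ, true_and] at he
    refine ⟨⟨Γ.cut e he.1, ?_⟩, Finset.mem_univ _, ?_⟩
    · unfold Connected
      rw [← graphWithout_glue, glue_cut, plusLeg_cut]
      exact he.2
    · simp only [Sigma.mk.injEq, Subtype.mk.injEq, heq_eq_eq]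
      exact ⟨glue_cut Γ e he.1, plusLeg_cut Γ e he.1⟩
  · intros; rfl

end Glue

/-! ### Fubini's theorem for the new edge. -/

section GlueIntegral

variable {n N H : ℕ} {ε : Fin n → ℤˣ} (Δ : Diagram (n + 2) N H (Fin.append ε ![1, -1]))
  {d : ℕ} (T : Theory d)

/-- The new edge of `Δ.glue`. -/
def newEdge : Δ.glue.Edge := ⟨Δ.plusLeg, (Δ.isHead_glue_iff _).2 (Or.inl rfl)⟩

/-- The edge of `Δ.glue` that comes from an edge of `Δ`. -/
def oldEdge (e : Δ.Edge) : Δ.glue.Edge := ⟨e.1, (Δ.isHead_glue_iff _).2 (Or.inr e.2)⟩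

/-- The edges of `Δ.glue` are the edges of `Δ` and the new one. -/
def glueEdgeEquiv : Option Δ.Edge ≃ Δ.glue.Edge :=
  Equiv.ofBijective (fun o => o.elim Δ.newEdge Δ.oldEdge) (by
    constructor
    · rintro (_ | e) (_ | e') h
      · rfl
      · exact absurd (congrArg Subtype.val h).symm (IsHead.ne_plusLeg Δ e'.2)
      · exact absurd (congrArg Subtype.val h) (IsHead.ne_plusLeg Δ e.2)
      · exact congrArg some (Subtype.ext (congrArg (fun f : Δ.glue.Edge => f.1) h))
    · intro f
      rcases (Δ.isHead_glue_iff _).1 f.2 with h | h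
      · exact ⟨none, Subtype.ext h.symm⟩
      · exact ⟨some ⟨f.1, h⟩, rfl⟩)

theorem glueEdgeEquiv_none : Δ.glueEdgeEquiv none = Δ.newEdge := rfl

theorem glueEdgeEquiv_some (e : Δ.Edge) : Δ.glueEdgeEquiv (some e) = Δ.oldEdge e := rfl

theorem edgeMeasure_newEdge : Δ.glue.edgeMeasure T Δ.newEdge = T.shellMeasure :=
  if_pos Δ.isPlusMinus_glue_plusLeg

theorem edgeFactor_newEdge (η : ℝ) (x : Mom d) :
    Δ.glue.edgeFactor T η Δ.newEdge x = T.M x.2 :=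
  if_pos Δ.isPlusMinus_glue_plusLeg

theorem edgeMeasure_oldEdge (e : Δ.Edge) :
    Δ.glue.edgeMeasure T (Δ.oldEdge e) = Δ.edgeMeasure T e := by
  have := Δ.isPlusMinus_glue_iff e.2
  unfold edgeMeasure
  rw [show (Δ.oldEdge e).1 = e.1 from rfl, this]

theorem edgeFactor_oldEdge (η : ℝ) (e : Δ.Edge) (x : Mom d) :
    Δ.glue.edgeFactor T η (Δ.oldEdge e) x = Δ.edgeFactor T η e x := by
  have := Δ.isPlusMinus_glue_iff e.2
  unfold edgeFactor
  rw [show (Δ.oldEdge e).1 = e.1 from rfl, this]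
  rfl

/-- The new edge variable `z.2` enters at the `+` end and `-z.2` at the `-` end, just as external
momenta enter the two legs; `mom_unique` does the rest. -/
theorem mom_glue (p : Fin n → Mom d) (z : (Δ.Edge → Mom d) × Mom d) (h : Fin H) :
    Δ.glue.mom p (insertVar Δ.glueEdgeEquiv z) h =
      Δ.mom (Fin.append p ![z.2, -z.2]) z.1 h := by
  have hplus : Δ.mom (Fin.append p ![z.2, -z.2]) z.1 Δ.plusLeg = z.2 := by
    rw [plusLeg, mom_leg, Fin.append_right]; rfl
  have hminus : Δ.mom (Fin.append p ![z.2, -z.2]) z.1 Δ.minusLeg = -z.2 := by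
    rw [minusLeg, mom_leg, Fin.append_right]; rfl
  refine mom_unique p _ _ (fun f => ?_) (fun f => ?_) (fun i => ?_) h
  · obtain ⟨o, rfl⟩ := Δ.glueEdgeEquiv.surjective f
    cases o with
    | none => rw [insertVar_none]; exact hplus
    | some e => rw [insertVar_some]; exact mom_head _ _ e
  · obtain ⟨o, rfl⟩ := Δ.glueEdgeEquiv.surjective f
    cases o with
    | none =>
      rw [insertVar_none, glueEdgeEquiv_none, newEdge, glue_pair_plusLeg, hminus]
    | some e =>
      rw [insertVar_some, glueEdgeEquiv_some, oldEdge,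
        Δ.glue_pair_of_ne (IsHead.ne_plusLeg Δ e.2) (IsHead.ne_minusLeg Δ e.2), mom_pair_head]
  · have := mom_leg (Γ := Δ) (Fin.append p ![z.2, -z.2]) z.1 (Fin.castAdd 2 i)
    rw [Fin.append_left] at this
    exact this

theorem integrand_glue (η : ℝ) (p : Fin n → Mom d) (z : (Δ.Edge → Mom d) × Mom d) :
    Δ.glue.integrand T η p (insertVar Δ.glueEdgeEquiv z) =
      T.M z.2.2 * Δ.integrand T η (Fin.append p ![z.2, -z.2]) z.1 := by
  have h1 : ∏ f, Δ.glue.edgeFactor T η f (insertVar Δ.glueEdgeEquiv z f) =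
      T.M z.2.2 * ∏ e, Δ.edgeFactor T η e (z.1 e) := by
    rw [← Equiv.prod_comp Δ.glueEdgeEquiv, Fintype.prod_option, insertVar_none,
      glueEdgeEquiv_none, edgeFactor_newEdge]
    congr 1
    refine Finset.prod_congr rfl fun e _ => ?_
    rw [insertVar_some, glueEdgeEquiv_some, edgeFactor_oldEdge]
  have h2 : ∀ v, Δ.glue.momAt p (insertVar Δ.glueEdgeEquiv z) v =
      Δ.momAt (Fin.append p ![z.2, -z.2]) z.1 v := fun v =>
    Multiset.map_congr rfl fun h _ => Δ.mom_glue p z h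
  unfold integrand
  rw [h1, mul_assoc]
  simp only [h2]
  rfl

theorem val_append_onShell (p : Fin n → T.Shell) (k : SMom d) :
    (fun i => (Fin.append p ![T.onShell (-1) k, -T.onShell (-1) k] i).1) =
      Fin.append (fun i => (p i).1) ![(-T.disp (-k), k), -(-T.disp (-k), k)] := by
  have hk : (T.onShell (-1) k).1 = (-T.disp (-k), k) := by
    have h : T.onShell (-1) k = ⟨(-T.disp (-k), k), Or.inr rfl⟩ := if_neg (by decide)
    rw [h]
  funext i
  induction i using Fin.addCases with
  | left i => rw [Fin.append_left, Fin.append_left]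
  | right j =>
    rw [Fin.append_right, Fin.append_right]
    fin_cases j
    · exact hk
    · exact congrArg Neg.neg hk

variable {T}

/-- Fubini's theorem for the new edge of `Δ.glue`. -/
theorem Converges.glue {η : ℝ} {p : Fin n → T.Shell} (hΔ : Δ.glue.Converges T η p) :
    T.IntegrableGpm (fun q => Δ.contribution T η (Fin.append p ![q, -q])) ∧
      Δ.glue.contribution T η p =
        T.intGpm (fun q => Δ.contribution T η (Fin.append p ![q, -q])) := by
  have hmp : MeasurePreserving (insertVar Δ.glueEdgeEquiv)
      ((Measure.pi (Δ.edgeMeasure T)).prod T.shellMeasure)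
      (Measure.pi (Δ.glue.edgeMeasure T)) := by
    have := measurePreserving_insertVar Δ.glueEdgeEquiv (Δ.glue.edgeMeasure T)
    simpa only [glueEdgeEquiv_none, glueEdgeEquiv_some, edgeMeasure_newEdge,
      edgeMeasure_oldEdge] using this
  have hemb := measurableEmbedding_insertVar (α := Mom d) Δ.glueEdgeEquiv
  let G : (Δ.Edge → Mom d) × Mom d → ℂ := fun z =>
    Δ.glue.integrand T η (fun i => (p i).1) (insertVar Δ.glueEdgeEquiv z)
  have hG : Integrable G ((Measure.pi (Δ.edgeMeasure T)).prod T.shellMeasure) :=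
    (hmp.integrable_comp_emb hemb).2 hΔ
  have hinner : ∀ k : SMom d, ∫ q, G (q, (-T.disp (-k), k)) ∂Measure.pi (Δ.edgeMeasure T) =
      T.M k * Δ.contribution T η (Fin.append p ![T.onShell (-1) k, -T.onShell (-1) k]) := by
    intro k
    unfold contribution
    -- Extracting the constant `T.M k` is valid for every `k`, including those at which the integral
    -- of `Δ` diverges.
    rw [val_append_onShell, ← integral_const_mul]
    exact integral_congr_ae (Eventually.of_forall fun q => Δ.integrand_glue T η _ _)
  have hint := (T.measurePreserving_shell.integrable_comp_emb T.measurableEmbedding_shell).2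
    hG.integral_prod_right
  have heq : Δ.glue.contribution T η p =
      ∫ k : SMom d, ∫ q, G (q, (-T.disp (-k), k)) ∂Measure.pi (Δ.edgeMeasure T) := by
    unfold contribution
    -- The shell variable is made the outer one, then parametrized by its spatial part.
    rw [← hmp.integral_comp hemb, integral_prod_symm _ hG,
      ← T.measurePreserving_shell.integral_comp T.measurableEmbedding_shell]
  constructor
  · unfold Theory.IntegrableGpm
    simp only [← hinner]
    exact hint
  · unfold Theory.intGpm
    simp only [← hinner]
    exact heq

end GlueIntegral

end Diagram

/-! ### The identity in a fixed order and the removal of the regulator. -/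

namespace Theory

variable {d : ℕ} (T : Theory d) {n : ℕ} (N H : ℕ) (ε : Fin n → ℤˣ)

theorem Ghat_eq_sum_labelled (η : ℝ) (p : Fin n → T.Shell) :
    T.Ghat N H η ε p =
      (∑ Γ : {Γ : Diagram n N H ε // Γ.Connected}, Γ.1.contribution T η p) /
        Nat.card (Equiv.Perm (Fin N) × Equiv.Perm (Fin H)) :=
  Diagram.sum_class_div_symm (fun Γ => Γ.contribution T η p)
    fun _ _ _ hφ => hφ.contribution_eq T η p

theorem sumNonSep_eq_sum_labelled (η : ℝ) (p : Fin n → T.Shell) :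
    T.sumNonSep N H η ε p =
      (∑ Γ : {Γ : Diagram n N H ε // Γ.Connected}, ∑ _e ∈ Γ.1.nonSepPM, Γ.1.contribution T η p) /
        Nat.card (Equiv.Perm (Fin N) × Equiv.Perm (Fin H)) := by
  rw [← Diagram.sum_class_div_symm (fun Γ => ∑ _e ∈ Γ.nonSepPM, Γ.contribution T η p)]
  · simp only [sumNonSep, Finset.sum_div]
  · intro Γ Δ φ hφ
    rw [Finset.sum_const, Finset.sum_const, hφ.card_nonSepPM, hφ.contribution_eq T η p]

theorem sumNonSep_eq_intGpm {η : ℝ} {p : Fin n → T.Shell}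
    (hconv : ∀ Γ : Diagram n N H ε, Γ.Connected → Γ.nonSepPM.Nonempty → Γ.Converges T η p) :
    T.IntegrableGpm (fun q => T.GhatCut N H η ε p q) ∧
      T.sumNonSep N H η ε p = T.intGpm (fun q => T.GhatCut N H η ε p q) := by
  have key : ∀ Δ : {Δ : Diagram (n + 2) N H (Fin.append ε ![1, -1]) // Δ.Connected},
      T.IntegrableGpm (fun q => Δ.1.contribution T η (Fin.append p ![q, -q])) ∧
      Δ.1.glue.contribution T η p =
        T.intGpm (fun q => Δ.1.contribution T η (Fin.append p ![q, -q])) := fun Δ =>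
    -- The joined diagram is connected and its new edge is non-separating, so the convergence
    -- hypothesis covers it.
    Diagram.Converges.glue Δ.1 (hconv _ Δ.2.glue ⟨_, Δ.2.plusLeg_mem_nonSepPM⟩)
  unfold IntegrableGpm intGpm at *
  simp only [GhatCut, Ghat_eq_sum_labelled, ← mul_div_assoc, Finset.mul_sum]
  refine ⟨(integrable_finsetSum _ fun Δ _ => (key Δ).1).div_const _, ?_⟩
  rw [integral_div, integral_finsetSum _ fun Δ _ => (key Δ).1, sumNonSep_eq_sum_labelled,
    Diagram.sum_nonSepPM (fun Γ => Γ.contribution T η p)]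
  congr 1
  exact Finset.sum_congr rfl fun Δ _ => (key Δ).2

/-- Regularized functions that agree almost everywhere have the same distributional limits. -/
theorem isLimit_congr {s : Fin n → ℤˣ} {F F' : ℝ → (Fin n → T.Shell) → ℂ}
    (h : ∀ η : ℝ, 0 < η → ∀ᵐ k : Fin n → SMom d,
      F η (fun i => T.onShell (s i) (k i)) = F' η (fun i => T.onShell (s i) (k i)))
    (L : ((Fin n → SMom d) → ℂ) → ℂ) : T.IsLimit s F L ↔ T.IsLimit s F' L := by
  have hev : ∀ f : (Fin n → SMom d) → ℂ, ∀ η ∈ Set.Ioi (0 : ℝ),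
      (fun k : Fin n → SMom d => f k * F η (fun i => T.onShell (s i) (k i))) =ᵐ[volume]
        fun k => f k * F' η (fun i => T.onShell (s i) (k i)) := fun f η hη => by
    filter_upwards [h η hη] with k hk
    rw [hk]
  unfold IsLimit
  refine forall_congr' fun f => imp_congr_right fun _ => imp_congr_right fun _ => and_congr ?_ ?_
  · refine eventually_congr ?_
    -- Near `0` from the right only `η > 0` occurs, where the two functions agree almost everywhere.
    filter_upwards [self_mem_nhdsWithin] with η hη
    exact integrable_congr (hev f η hη)
  · refine tendsto_congr' ?_
    filter_upwards [self_mem_nhdsWithin] with η hη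
    exact integral_congr_ae (hev f η hη)

end Theory

end Keldysh

end

theorem lemma4 {d : ℕ} (T : Keldysh.Theory d) (n N H : ℕ) (ε : Fin n → ℤˣ) :
    (∀ η : ℝ, 0 < η → ∀ p : Fin n → T.Shell,
      (∀ Γ : Keldysh.Diagram n N H ε, Γ.Connected → Γ.nonSepPM.Nonempty → Γ.Converges T η p) →
        T.IntegrableGpm (fun q => T.GhatCut N H η ε p q) ∧
        T.sumNonSep N H η ε p = T.intGpm (fun q => T.GhatCut N H η ε p q)) ∧
    (∀ s : Fin n → ℤˣ,
      (∀ η : ℝ, 0 < η → ∀ᵐ k : Fin n → Keldysh.SMom d,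
        ∀ Γ : Keldysh.Diagram n N H ε, Γ.Connected → Γ.nonSepPM.Nonempty →
          Γ.Converges T η (fun i => T.onShell (s i) (k i))) →
        ∀ L : ((Fin n → Keldysh.SMom d) → ℂ) → ℂ,
          T.IsLimit s (fun η p => T.sumNonSep N H η ε p) L ↔
          T.IsLimit s (fun η p => T.intGpm (fun q => T.GhatCut N H η ε p q)) L) := by
  refine ⟨fun η _ p hconv => T.sumNonSep_eq_intGpm N H ε hconv, fun s hconv L => ?_⟩
  -- `IsLimit` ignores null sets of spatial momenta, so convergence at almost all of them suffices.
  refine T.isLimit_congr (fun η hη => ?_) L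
  filter_upwards [hconv η hη] with k hk
  exact (T.sumNonSep_eq_intGpm N H ε hk).2
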